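/- **Conventions.** For a commutative $\mathbb{C}$-algebra $A$ let $D_A$ be its ring of Grothendieck differential operators; for a homomorphism $\varphi:A\to B$ of commutative $\mathbb{C}$-algebras let $\mathrm{Diff}_\varphi(A,B)$ be the $(D_B,D_A)$-bimodule of differential operators $A\to B$, where $B$ is an $A$-module through $\varphi$. If $V=\operatorname{Spec}A$ is a smooth affine variety over $\mathbb{C}$ and $X\subseteq V$ is a closed subvariety with (radical) ideal $I$, a *$D$-module on $X$* is a right $D_A$-module $M$ whose support in $V$ (the set of primes $\mathfrak p$ with $M_{\mathfrak p}\neq 0$) is contained in $X$, and $D_X=I D_A\backslash D_A$ is the canonical $D$-module of $X$. For an arbitrary variety $X$ (a reduced separated scheme of finite type over $\mathbb{C}$), a *chart* is an affine open $U\subseteq X$ with a closed embedding $U\hookrightarrow V=\operatorname{Spec}A$ into a smooth affine variety; a morphism of charts $(U'\hookrightarrow V')\to(U\hookrightarrow V)$ consists of an inclusion $U'\subseteq U$ and a morphism $V'\to V$ extending it. A *$D$-module $M$ on $X$* is obtained by gluing: it consists of a $D$-module $M_{U\hookrightarrow V}$ on $U$ (a right $D_A$-module supported on $U$) for each chart,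 and, for each morphism of charts with comorphism $\varphi:A\to A'$, a $D_A$-linear map $M_{U\hookrightarrow V}\to M_{U'\hookrightarrow V'}\otimes_{D_{A'}}\mathrm{Diff}_\varphi(A,A')$ which becomes an isomorphism over every principal open subset of $V$ whose intersection with $U$ lies in $U'$; these maps are compatible with identities and with composition. $M$ is *supported at a point* if the set of points of $X$ at which $M$ is nonzero is contained in $\{x\}$ for some $x\in X$. The sheaf $\mathcal{E}xt^i(D_X,M)$ on $X$ has sections $\operatorname{Ext}^i_{D_A}(D_U,M_{U\hookrightarrow V})$ over $U$, the Ext group being taken in the category of right $D_A$-modules. **Proposition.** 1. Let $X$ be a closed subvariety of a smooth affine variety $V=\operatorname{Spec}A$ over $\mathbb{C}$, and let $M$ be a $D$-module on $X$ which is supported at a point. Then $\operatorname{Ext}^i_{D_A}(D_X,M)=0$ for all $i\ge 1$. 2. Let $X$ be any variety over $\mathbb{C}$ and let $M$ be a $D$-module on $X$ which is supported at a point. Then $\mathcal{E}xt^i(D_X,M)=0$ for all $i\geq 1$; more precisely, $\operatorname{Ext}^i_{D_A}(D_U,M_{U\hookrightarrow V})=0$ for all $i\ge 1$ and every affine open $U\subseteq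 X$ with a closed embedding $U\hookrightarrow V=\operatorname{Spec}A$ into a smooth affine variety. -/

import Mathlib

open CategoryTheory AlgebraicGeometry TopologicalSpace TensorProduct

noncomputable section

namespace DMod

/-! ### Grothendieck differential operators -/

section DiffOp

variable {A B C : Type} [CommRing A] [Algebra ℂ A] [CommRing B] [Algebra ℂ B]
  [CommRing C] [Algebra ℂ C]

/-- Multiplication by `a`, as a `ℂ`-linear endomorphism of `A`. -/
def mulOp (a : A) : A →ₗ[ℂ] A := LinearMap.mulLeft ℂ a

/-- The commutator `[T, a] = T ∘ a - φ(a) ∘ T` of a `ℂ`-linear map `T : A → B` with `a ∈ A`,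
where `B` is an `A`-module through `φ`. -/
def comm (φ : A →ₐ[ℂ] B) (T : A →ₗ[ℂ] B) (a : A) : A →ₗ[ℂ] B :=
  T ∘ₗ mulOp a - mulOp (φ a) ∘ₗ T

/-- `IsDiffOp φ n T`: the map `T : A → B` is a (Grothendieck) differential operator of order `≤ n`
between the `A`-modules `A` and `B`, where `B` is an `A`-module through `φ`. -/
def IsDiffOp (φ : A →ₐ[ℂ] B) : ℕ → (A →ₗ[ℂ] B) → Prop
  | 0, T => ∀ a, comm φ T a = 0
  | n + 1, T => ∀ a, IsDiffOp φ n (comm φ T a)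

theorem comm_zero (φ : A →ₐ[ℂ] B) (a : A) : comm φ 0 a = 0 := by
  ext x; simp [comm]

theorem comm_add (φ : A →ₐ[ℂ] B) (S T : A →ₗ[ℂ] B) (a : A) :
    comm φ (S + T) a = comm φ S a + comm φ T a := by
  ext x; simp [comm, mulOp]; ring

theorem comm_smul (φ : A →ₐ[ℂ] B) (r : ℂ) (T : A →ₗ[ℂ] B) (a : A) :
    comm φ (r • T) a = r • comm φ T a := by
  ext x; simp [comm, mulOp, smul_sub]

theorem comm_comp (φ : A →ₐ[ℂ] B) (ψ : B →ₐ[ℂ] C) (S : B →ₗ[ℂ] C) (T : A →ₗ[ℂ] B) (a : A) :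
    comm (ψ.comp φ) (S ∘ₗ T) a = S ∘ₗ comm φ T a + comm ψ S (φ a) ∘ₗ T := by
  ext x; simp [comm, mulOp]

theorem isDiffOp_zero_map (φ : A →ₐ[ℂ] B) (n : ℕ) : IsDiffOp φ n 0 := by
  induction n with
  | zero => exact comm_zero φ
  | succ n ih => intro a; rw [comm_zero]; exact ih

theorem IsDiffOp.succ {φ : A →ₐ[ℂ] B} {n : ℕ} {T : A →ₗ[ℂ] B} (h : IsDiffOp φ n T) :
    IsDiffOp φ (n + 1) T := by
  induction n generalizing T with
  | zero => intro a; rw [h a]; exact isDiffOp_zero_map φ 0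
  | succ n ih => intro a; exact ih (h a)

theorem IsDiffOp.mono {φ : A →ₐ[ℂ] B} {m n : ℕ} (hmn : m ≤ n) {T : A →ₗ[ℂ] B}
    (h : IsDiffOp φ m T) : IsDiffOp φ n T := by
  induction hmn with
  | refl => exact h
  | step _ ih => exact ih.succ

theorem IsDiffOp.add {φ : A →ₐ[ℂ] B} {n : ℕ} {S T : A →ₗ[ℂ] B} (hS : IsDiffOp φ n S)
    (hT : IsDiffOp φ n T) : IsDiffOp φ n (S + T) := by
  induction n generalizing S T with
  | zero => intro a; rw [comm_add, hS a, hT a, add_zero]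
  | succ n ih => intro a; rw [comm_add]; exact ih (hS a) (hT a)

theorem IsDiffOp.smul {φ : A →ₐ[ℂ] B} {n : ℕ} (r : ℂ) {T : A →ₗ[ℂ] B}
    (hT : IsDiffOp φ n T) : IsDiffOp φ n (r • T) := by
  induction n generalizing T with
  | zero => intro a; rw [comm_smul, hT a, smul_zero]
  | succ n ih => intro a; rw [comm_smul]; exact ih (hT a)

theorem IsDiffOp.comp {φ : A →ₐ[ℂ] B} {ψ : B →ₐ[ℂ] C} {k m n : ℕ} (hk : m + n ≤ k)
    {S : B →ₗ[ℂ] C} {T : A →ₗ[ℂ] B} (hS : IsDiffOp ψ m S) (hT : IsDiffOp φ n T) :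
    IsDiffOp (ψ.comp φ) k (S ∘ₗ T) := by
  induction k generalizing m n S T with
  | zero =>
    obtain rfl : m = 0 := by omega
    obtain rfl : n = 0 := by omega
    intro a
    rw [comm_comp, hT a, hS (φ a), LinearMap.comp_zero, LinearMap.zero_comp, add_zero]
  | succ k ih =>
    intro a
    rw [comm_comp]
    refine IsDiffOp.add ?_ ?_
    · cases n with
      | zero => rw [hT a, LinearMap.comp_zero]; exact isDiffOp_zero_map _ _
      | succ n => exact ih (by omega) hS (hT a)
    · cases m with
      | zero => rw [hS (φ a), LinearMap.zero_comp]; exact isDiffOp_zero_map _ _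
      | succ m => exact ih (by omega) (hS (φ a)) hT

theorem isDiffOp_mulOp (a : A) : IsDiffOp (AlgHom.id ℂ A) 0 (mulOp a) := by
  intro b
  ext x
  simp only [comm, mulOp, LinearMap.sub_apply, LinearMap.comp_apply, LinearMap.mulLeft_apply,
    AlgHom.id_apply, LinearMap.zero_apply]
  ring

theorem isDiffOp_one : IsDiffOp (AlgHom.id ℂ A) 0 (LinearMap.id : A →ₗ[ℂ] A) := by
  intro b
  ext x
  simp [comm, mulOp]

/-- `Diff(A, B)`: all differential operators `A → B`, where `B` is an `A`-module through `φ`.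
For `A = O(V)` and `B = O(V')` with `V`, `V'` smooth this is the transfer bimodule `D_{V' → V}`. -/
def Transfer (φ : A →ₐ[ℂ] B) : Submodule ℂ (A →ₗ[ℂ] B) where
  carrier := {T | ∃ n, IsDiffOp φ n T}
  add_mem' := by
    rintro S T ⟨m, hS⟩ ⟨n, hT⟩
    exact ⟨max m n, (hS.mono (le_max_left m n)).add (hT.mono (le_max_right m n))⟩
  zero_mem' := ⟨0, isDiffOp_zero_map φ 0⟩
  smul_mem' := by
    rintro r T ⟨n, hT⟩
    exact ⟨n, hT.smul r⟩

variable (A) in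
/-- `D_V = Diff(A)` for `A = O(V)`: the ring of Grothendieck differential operators of `A`, with
composition as multiplication. -/
def D : Subalgebra ℂ (Module.End ℂ A) where
  carrier := {T | ∃ n, IsDiffOp (AlgHom.id ℂ A) n T}
  mul_mem' := by
    rintro S T ⟨m, hS⟩ ⟨n, hT⟩
    exact ⟨m + n, IsDiffOp.comp (φ := AlgHom.id ℂ A) (ψ := AlgHom.id ℂ A) le_rfl hS hT⟩
  add_mem' := by
    rintro S T ⟨m, hS⟩ ⟨n, hT⟩
    exact ⟨max m n, (hS.mono (le_max_left m n)).add (hT.mono (le_max_right m n))⟩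
  algebraMap_mem' := by
    intro r
    exact ⟨0, by
      have h := (isDiffOp_one (A := A)).smul r
      exact h⟩

/-- A function `a ∈ A`, as the differential operator of multiplication by `a`. -/
def fn (a : A) : D A := ⟨mulOp a, 0, isDiffOp_mulOp a⟩

/-- The composite `S ∘ T` of differential operators `T : A → B` and `S : B → C`. -/
def tcomp {φ : A →ₐ[ℂ] B} {ψ : B →ₐ[ℂ] C} {χ : A →ₐ[ℂ] C} (h : χ = ψ.comp φ)
    (S : Transfer ψ) (T : Transfer φ) : Transfer χ :=
  ⟨S.1 ∘ₗ T.1, by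
    subst h
    obtain ⟨m, hS⟩ := S.2
    obtain ⟨n, hT⟩ := T.2
    exact ⟨m + n, hS.comp le_rfl hT⟩⟩

/-- An element of `D A` is the same as an element of `Transfer (AlgHom.id ℂ A)`. -/
def toT (P : D A) : Transfer (AlgHom.id ℂ A) := ⟨P.1, P.2⟩

/-- The left action of `D B` on `Diff(A, B)`, by composition. -/
def lcomp {φ : A →ₐ[ℂ] B} (P : D B) (T : Transfer φ) : Transfer φ :=
  tcomp (AlgHom.id_comp φ).symm (toT P) T

/-! ### Direct images of right modules -/

variable (φ : A →ₐ[ℂ] B) (N : Type) [AddCommGroup N] [Module (D B)ᵐᵒᵖ N]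

/-- The relations `(n · P) ⊗ T = n ⊗ (P ∘ T)`, for `P ∈ D B`. -/
def pushRel : Submodule ℤ (N ⊗[ℤ] Transfer φ) :=
  Submodule.span ℤ {z | ∃ (n : N) (P : D B) (T : Transfer φ),
    z = (MulOpposite.op P • n) ⊗ₜ[ℤ] T - n ⊗ₜ[ℤ] lcomp P T}

/-- The direct image `N ⊗_{D B} Diff(A, B)` of a right `D B`-module `N` along
`Spec B → Spec A`. -/
def Push : Type := (N ⊗[ℤ] Transfer φ) ⧸ pushRel φ N

instance : AddCommGroup (Push φ N) :=
  inferInstanceAs (AddCommGroup ((N ⊗[ℤ] Transfer φ) ⧸ pushRel φ N))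

variable {φ N}

/-- The class `n ⊗ T`. -/
def Push.mk (n : N) (T : Transfer φ) : Push φ N := (pushRel φ N).mkQ (n ⊗ₜ[ℤ] T)

theorem Push.mk_op_smul (n : N) (P : D B) (T : Transfer φ) :
    Push.mk (MulOpposite.op P • n) T = Push.mk n (lcomp P T) := by
  refine (Submodule.Quotient.eq (pushRel φ N)).2 ?_
  exact Submodule.subset_span ⟨n, P, T, rfl⟩

theorem Push.mk_add_left (n n' : N) (T : Transfer φ) :
    Push.mk (n + n') T = Push.mk n T + Push.mk n' T := by
  simp only [Push.mk, add_tmul, map_add]; rfl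

theorem Push.mk_add_right (n : N) (T T' : Transfer φ) :
    Push.mk n (T + T') = Push.mk n T + Push.mk n T' := by
  simp only [Push.mk, tmul_add, map_add]; rfl

theorem Push.induction {p : Push φ N → Prop} (h0 : p 0) (hmk : ∀ n T, p (Push.mk n T))
    (hadd : ∀ x y, p x → p y → p (x + y)) (z : Push φ N) : p z := by
  obtain ⟨w, rfl⟩ := (pushRel φ N).mkQ_surjective z
  induction w using TensorProduct.induction_on with
  | zero => rw [map_zero]; exact h0
  | tmul n T => exact hmk n T
  | add x y hx hy => rw [map_add]; exact hadd _ _ hx hy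

/-- Balanced biadditive maps out of `N × Diff(A, B)` descend to the direct image. -/
def Push.lift {G : Type} [AddCommGroup G] (f : N →+ Transfer φ →+ G)
    (hf : ∀ (n : N) (P : D B) (T : Transfer φ), f (MulOpposite.op P • n) T = f n (lcomp P T)) :
    Push φ N →+ G :=
  ((pushRel φ N).liftQ
    (TensorProduct.liftAddHom f (fun r n T => by
      rw [map_zsmul]; exact (map_intCast_smul (f n) ℤ ℤ r T).symm)).toIntLinearMap (by
      refine Submodule.span_le.2 ?_
      rintro z ⟨n, P, T, rfl⟩
      simp [hf])).toAddMonoidHom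

@[simp] theorem Push.lift_mk {G : Type} [AddCommGroup G] (f : N →+ Transfer φ →+ G)
    (hf : ∀ (n : N) (P : D B) (T : Transfer φ), f (MulOpposite.op P • n) T = f n (lcomp P T))
    (n : N) (T : Transfer φ) : Push.lift f hf (Push.mk n T) = f n T :=
  rfl

theorem Push.hom_ext {G : Type} [AddCommGroup G] {f g : Push φ N →+ G}
    (h : ∀ n T, f (Push.mk n T) = g (Push.mk n T)) : f = g := by
  ext z
  induction z using Push.induction with
  | h0 => simp
  | hmk n T => exact h n T
  | hadd x y hx hy => rw [map_add, map_add, hx, hy]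

/-- For `T ∈ Diff(A, B)`, the map `N ⊗ Diff(B, C) → N ⊗ Diff(A, C)`, `n ⊗ S ↦ n ⊗ (S ∘ T)`. -/
def Push.precomp {φ : A →ₐ[ℂ] B} {ψ : B →ₐ[ℂ] C} {χ : A →ₐ[ℂ] C} (h : χ = ψ.comp φ)
    {N : Type} [AddCommGroup N] [Module (D C)ᵐᵒᵖ N] (T : Transfer φ) :
    Push ψ N →+ Push χ N :=
  Push.lift (AddMonoidHom.mk' (fun n => AddMonoidHom.mk' (fun S => Push.mk n (tcomp h S T))
      (fun S S' => by
        rw [← Push.mk_add_right]; congr 1))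
      (fun n n' => by
        ext S; exact Push.mk_add_left n n' _))
    (fun n P S => by
      refine (Push.mk_op_smul n P (tcomp h S T)).trans ?_
      rfl)

@[simp] theorem Push.precomp_mk {φ : A →ₐ[ℂ] B} {ψ : B →ₐ[ℂ] C} {χ : A →ₐ[ℂ] C}
    (h : χ = ψ.comp φ) {N : Type} [AddCommGroup N] [Module (D C)ᵐᵒᵖ N] (T : Transfer φ)
    (n : N) (S : Transfer ψ) :
    Push.precomp h T (Push.mk n S) = Push.mk n (tcomp h S T) :=
  rfl

theorem Push.precomp_add {φ : A →ₐ[ℂ] B} {ψ : B →ₐ[ℂ] C} {χ : A →ₐ[ℂ] C}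
    (h : χ = ψ.comp φ) {N : Type} [AddCommGroup N] [Module (D C)ᵐᵒᵖ N] (T T' : Transfer φ) :
    Push.precomp (N := N) h (T + T') = Push.precomp h T + Push.precomp h T' := by
  refine Push.hom_ext fun n S => ?_
  rw [AddMonoidHom.add_apply, precomp_mk, precomp_mk, precomp_mk, ← Push.mk_add_right]
  congr 1
  exact Subtype.ext (LinearMap.comp_add _ _ _)

variable (φ N) in
/-- The right action of `D A` on the direct image: `(n ⊗ S) · P = n ⊗ (S ∘ P)`. -/
def Push.act : (D A)ᵐᵒᵖ →+* AddMonoid.End (Push φ N) where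
  toFun P := Push.precomp (AlgHom.comp_id φ).symm (toT P.unop)
  map_one' := Push.hom_ext fun n S => by rw [Push.precomp_mk]; rfl
  map_mul' P Q := Push.hom_ext fun n S => by
    rfl
  map_zero' := Push.hom_ext fun n S => by
    have h := Push.precomp_add (N := N) (AlgHom.comp_id φ).symm (0 : Transfer (AlgHom.id ℂ A)) 0
    rw [add_zero, left_eq_add] at h
    exact DFunLike.congr_fun h _
  map_add' P Q := Push.precomp_add (AlgHom.comp_id φ).symm (toT P.unop) (toT Q.unop)

instance : Module (D A)ᵐᵒᵖ (Push φ N) := Module.compHom (Push φ N) (Push.act φ N)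

theorem Push.op_smul_mk (n : N) (S : Transfer φ) (P : D A) :
    MulOpposite.op P • Push.mk n S = Push.mk n (tcomp (AlgHom.comp_id φ).symm S (toT P)) :=
  Push.precomp_mk _ _ _ _

theorem Push.precomp_lcomp {φ : A →ₐ[ℂ] B} {ψ : B →ₐ[ℂ] C} {χ : A →ₐ[ℂ] C}
    (h : χ = ψ.comp φ) {N : Type} [AddCommGroup N] [Module (D C)ᵐᵒᵖ N] (P : D B) (T : Transfer φ)
    (z : Push ψ N) :
    Push.precomp h T (MulOpposite.op P • z) = Push.precomp h (lcomp P T) z := by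
  induction z using Push.induction with
  | h0 => simp
  | hmk n S => rw [Push.op_smul_mk, precomp_mk, precomp_mk]; rfl
  | hadd x y hx hy => rw [smul_add, map_add, map_add, hx, hy]

/-- For a map `g : N' → N ⊗ Diff(B, C)` of right `D B`-modules, the composite
`N' ⊗ Diff(A, B) → (N ⊗ Diff(B, C)) ⊗ Diff(A, B) → N ⊗ Diff(A, C)` of `g ⊗ id` with
composition of differential operators. -/
def Push.bind {φ : A →ₐ[ℂ] B} {ψ : B →ₐ[ℂ] C} {χ : A →ₐ[ℂ] C} (h : χ = ψ.comp φ)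
    {N' N : Type} [AddCommGroup N'] [Module (D B)ᵐᵒᵖ N'] [AddCommGroup N] [Module (D C)ᵐᵒᵖ N]
    (g : N' →ₗ[(D B)ᵐᵒᵖ] Push ψ N) : Push φ N' →+ Push χ N :=
  Push.lift (AddMonoidHom.mk' (fun n => AddMonoidHom.mk' (fun T => Push.precomp h T (g n))
      (fun T T' => by rw [Push.precomp_add]; rfl))
      (fun n n' => by ext T; simp))
    (fun n P T => by
      simp only [AddMonoidHom.mk'_apply, map_smul]
      exact Push.precomp_lcomp h P T (g n))

@[simp] theorem Push.bind_mk {φ : A →ₐ[ℂ] B} {ψ : B →ₐ[ℂ] C} {χ : A →ₐ[ℂ] C} (h : χ = ψ.comp φ)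
    {N' N : Type} [AddCommGroup N'] [Module (D B)ᵐᵒᵖ N'] [AddCommGroup N] [Module (D C)ᵐᵒᵖ N]
    (g : N' →ₗ[(D B)ᵐᵒᵖ] Push ψ N) (n : N') (T : Transfer φ) :
    Push.bind h g (Push.mk n T) = Push.precomp h T (g n) :=
  rfl

end DiffOp

/-! ### Support and the canonical `D`-module on an affine variety -/

section Affine

variable (A : Type) [CommRing A] [Algebra ℂ A]

/-- The support in `V = Spec A` of a right `D A`-module `M` (as an `A`-module): the primes `p` at
which the localization of `M` is nonzero. -/
def supp (M : Type) [AddCommGroup M] [Module (D A)ᵐᵒᵖ M] : Set (PrimeSpectrum A) :=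
  {p | ∃ m : M, ∀ a : A, a ∉ p.asIdeal → MulOpposite.op (fn a) • m ≠ 0}

/-- The cyclic right `R`-module `S R \ R`, the quotient of `R` by the right ideal `S R` generated
by a set `S`. -/
abbrev cyclicRight {R : Type} [Ring R] (S : Set R) : ModuleCat.{0} Rᵐᵒᵖ :=
  ModuleCat.of Rᵐᵒᵖ (R ⧸ Submodule.span Rᵐᵒᵖ S)

variable {A}

/-- The canonical right `D_V`-module `D_X = I D_V \ D_V` of the closed subvariety `X` of
`V = Spec A` with ideal `I`. -/
abbrev canonicalModule (I : Ideal A) : ModuleCat.{0} (D A)ᵐᵒᵖ :=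
  cyclicRight (fn '' (I : Set A))

end Affine

/-! ### `D`-modules on a variety -/

section Global

variable {X : Scheme.{0}} (f : X ⟶ Spec (CommRingCat.of ℂ))

/-- The `ℂ`-algebra structure map of `Γ(X, U)`, for a scheme `X` over `ℂ`. -/
def scalars (U : X.Opens) : ℂ →+* Γ(X, U) :=
  ((Scheme.ΓSpecIso (CommRingCat.of ℂ)).inv ≫ f.appTop ≫
    X.presheaf.map (homOfLE (le_top : U ≤ ⊤)).op).hom

/-- A chart of `X`: an affine open `U` of `X` together with a closed embedding over `ℂ` of `U` into
a smooth affine variety `V = Spec A`. -/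
structure Chart where
  U : X.Opens
  isAffine : IsAffineOpen U
  A : Type
  [ring : CommRing A]
  [alg : Algebra ℂ A]
  [smooth : Algebra.Smooth ℂ A]
  π : A →+* Γ(X, U)
  surj : Function.Surjective π
  comp_algebraMap : π.comp (algebraMap ℂ A) = scalars f U

attribute [instance] Chart.ring Chart.alg Chart.smooth

variable {f}

/-- The ideal of `U` in `V`. -/
def Chart.ideal (c : Chart f) : Ideal c.A := RingHom.ker c.π

/-- The image in `V` of the point `x` of `U`. -/
def Chart.point (c : Chart f) (x : X) (hx : x ∈ c.U) : PrimeSpectrum c.A :=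
  PrimeSpectrum.comap ((X.presheaf.germ c.U x hx).hom.comp c.π)
    (IsLocalRing.closedPoint (X.presheaf.stalk x))

/-- A morphism from the chart `c' = (U' ⊆ V')` to the chart `c = (U ⊆ V)`: an inclusion `U' ⊆ U`
and a morphism `V' → V` which extends it. -/
structure ChartHom (c' c : Chart f) where
  le : c'.U ≤ c.U
  φ : c.A →ₐ[ℂ] c'.A
  comm : ∀ a, c'.π (φ a) = X.presheaf.map (homOfLE le).op (c.π a)

/-- The identity morphism of a chart. -/
def ChartHom.id (c : Chart f) : ChartHom c c where
  le := le_rfl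
  φ := AlgHom.id ℂ c.A
  comm a := by
    have h : (homOfLE (le_refl c.U)).op = 𝟙 (Opposite.op c.U) := rfl
    rw [h, X.presheaf.map_id]; rfl

/-- Composition of morphisms of charts. -/
def ChartHom.comp {c'' c' c : Chart f} (s : ChartHom c'' c') (t : ChartHom c' c) :
    ChartHom c'' c where
  le := s.le.trans t.le
  φ := s.φ.comp t.φ
  comm a := by
    have h : (homOfLE (s.le.trans t.le)).op = (homOfLE t.le).op ≫ (homOfLE s.le).op := rfl
    rw [h, X.presheaf.map_comp, AlgHom.comp_apply, s.comm, t.comm]; rfl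

variable (f) in
/-- A (right, quasi-coherent) `D`-module on the variety `X`, glued from the Kashiwara categories of
its affine opens. For every closed embedding of an affine open `U` into a smooth affine `V`, it has
a right `D_V`-module supported on `U`. For every morphism of charts `(U' ⊆ V') → (U ⊆ V)`, it has a
`D_V`-linear map from the module on `V` to the direct image of the module on `V'`, such that the
sheaves on `V` which these two modules define agree, through this map, over every principal open
of `V` whose intersection with `U` lies in `U'`; these maps are compatible with identities and
composition. -/
structure DModule where
  /-- the right `D_V`-module on the chart `c` -/
  obj : ∀ c : Chart f, ModuleCat.{0} (D c.A)ᵐᵒᵖ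
  supp_subset : ∀ c, supp c.A (obj c) ⊆ PrimeSpectrum.zeroLocus (c.ideal : Set c.A)
  /-- the restriction map -/
  res : ∀ {c' c : Chart f} (t : ChartHom c' c),
    obj c →ₗ[(D c.A)ᵐᵒᵖ] Push t.φ (obj c')
  res_id : ∀ (c : Chart f) (m : obj c), res (ChartHom.id c) m = Push.mk m (toT 1)
  res_comp : ∀ {c'' c' c : Chart f} (s : ChartHom c'' c') (t : ChartHom c' c) (m : obj c),
    res (s.comp t) m = Push.bind (χ := (s.comp t).φ) rfl (res s) (res t m)
  res_inj : ∀ {c' c : Chart f} (t : ChartHom c' c) (h : c.A), X.basicOpen (c.π h) ≤ c'.U →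
    ∀ m : obj c, res t m = 0 → ∃ k : ℕ, MulOpposite.op (fn (h ^ k)) • m = 0
  res_surj : ∀ {c' c : Chart f} (t : ChartHom c' c) (h : c.A), X.basicOpen (c.π h) ≤ c'.U →
    ∀ y : Push t.φ (obj c'), ∃ (k : ℕ) (m : obj c), MulOpposite.op (fn (h ^ k)) • y = res t m

/-- The support of a `D`-module on `X`, a set of points of `X`. -/
def DModule.support (M : DModule f) : Set X :=
  {x | ∃ (c : Chart f) (hx : x ∈ c.U), c.point x hx ∈ supp c.A (M.obj c)}

end Global

end DMod

end

noncomputable section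

namespace DMod

open scoped RightActions

/-! ### Injectivity over a Noetherian ring of a module supported at a closed point -/

section Matlis

/-! Homomorphisms from the cyclic module `canonicalModule I` are elements killed by `I`, so the Ext
groups depend only on the `A`-module structure of an injective resolution. It therefore suffices
that `M` is injective over `A` and that injective right `D A`-modules stay injective over `A`. The
latter holds because `D A` is flat as a left `A`-module (`equationallyFlat_fnHom`). In `0 → M → J →
Q → 0` the module `M` then splits off over `A`: the splitting corrects lifts (`exists_lift_of_baer`)
and makes `Q` injective over `A` again (`baer_of_exact`), and dimension shifting finishes
(`EquationallyFlat.subsingleton_ext`).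

For the injectivity of `M` over `A` (`baer_of_supp_subsingleton`), Artin–Rees and Noetherian
induction reduce Baer's criterion to maps `g : 𝔪 → M`, that is, to `Ext¹(A/𝔪, M) = 0`. This is a
Poincaré lemma: the Euler operator `∑ x i * δ i` acts on the graded pieces of the `𝔪`-power torsion
filtration by integers `k ≥ 0`, so contracting `g` with the `δ i` recovers `(k + 1) g` up to lower
terms, and `k + 1` is invertible.

Flatness comes from Taylor expansion: smoothness lifts `a ↦ 1 ⊗ a` to truncated polynomials over
`A`, whose coefficients form a finite dual basis for operators of bounded order
(`exists_dualBasis`). -/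

theorem exists_rangeFactor {R F N M : Type} [Ring R] [AddCommGroup F] [Module R F]
    [AddCommGroup N] [Module R N] [AddCommGroup M] [Module R M] (f : F →ₗ[R] N) (g : F →ₗ[R] M)
    (h : ∀ x, f x = 0 → g x = 0) :
    ∃ k : LinearMap.range f →ₗ[R] M, ∀ x, k ⟨f x, x, rfl⟩ = g x := by
  refine ⟨(LinearMap.ker f).liftQ g (fun x hx => h x hx) ∘ₗ
    f.quotKerEquivRange.symm.toLinearMap, fun x => ?_⟩
  have : f.quotKerEquivRange.symm ⟨f x, x, rfl⟩ = (LinearMap.ker f).mkQ x := by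
    rw [LinearEquiv.symm_apply_eq]; rfl
  simp only [LinearMap.comp_apply, LinearEquiv.coe_coe, this]
  exact Submodule.liftQ_apply _ _ _

variable {A : Type} [CommRing A] {M : Type} [AddCommGroup M] [Module A M] {𝔪 : Ideal A}

/-- The elements of `M` which are killed by `𝔪 ^ k`. -/
abbrev powTorsion (𝔪 : Ideal A) (M : Type) [AddCommGroup M] [Module A M] (k : ℕ) :
    Submodule A M :=
  Submodule.torsionBySet A M ((𝔪 ^ k : Ideal A) : Set A)

theorem mem_powTorsion {k : ℕ} {m : M} : m ∈ powTorsion 𝔪 M k ↔ ∀ a ∈ 𝔪 ^ k, a • m = 0 := by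
  simp [Submodule.mem_torsionBySet_iff]

theorem powTorsion_mono {k l : ℕ} (h : k ≤ l) : powTorsion 𝔪 M k ≤ powTorsion 𝔪 M l :=
  fun _ hm => mem_powTorsion.2 fun a ha => mem_powTorsion.1 hm a (Ideal.pow_le_pow_right h ha)

theorem eq_zero_of_mem_powTorsion_zero {m : M} (hm : m ∈ powTorsion 𝔪 M 0) : m = 0 := by
  simpa using mem_powTorsion.1 hm 1 (by simp)

theorem smul_mem_powTorsion {j k : ℕ} {y : A} (hy : y ∈ 𝔪 ^ j) {m : M}
    (hm : m ∈ powTorsion 𝔪 M (k + j)) : y • m ∈ powTorsion 𝔪 M k :=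
  mem_powTorsion.2 fun a ha => by
    rw [smul_smul]
    exact mem_powTorsion.1 hm _ (by rw [pow_add]; exact Ideal.mul_mem_mul ha hy)

theorem mem_powTorsion_succ {k : ℕ} {m : M} (h : ∀ y ∈ 𝔪, y • m ∈ powTorsion 𝔪 M k) :
    m ∈ powTorsion 𝔪 M (k + 1) :=
  mem_powTorsion.2 fun a ha => by
    rw [pow_succ] at ha
    refine Submodule.mul_induction_on ha (fun a ha y hy => ?_) fun a b ha hb => ?_
    · rw [mul_smul]; exact mem_powTorsion.1 (h y hy) a ha
    · rw [add_smul, ha, hb, add_zero]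

theorem exists_range_le_powTorsion [IsNoetherianRing A] (htors : ∀ m : M, ∃ k, m ∈ powTorsion 𝔪 M k)
    {I : Ideal A} (g : I →ₗ[A] M) : ∃ k, ∀ x, g x ∈ powTorsion 𝔪 M k := by
  obtain ⟨n, f, hf⟩ := Module.Finite.exists_fin' A I
  choose k hk using fun i => htors (g (f (Pi.single i 1)))
  refine ⟨Finset.univ.sup k, fun x => ?_⟩
  obtain ⟨c, rfl⟩ := hf x
  rw [LinearMap.pi_apply_eq_sum_univ f c, map_sum]
  refine Submodule.sum_mem _ fun i _ => ?_
  rw [map_smul]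
  refine Submodule.smul_mem _ _ (powTorsion_mono (Finset.le_sup (Finset.mem_univ i)) ?_)
  convert hk i using 4 with j
  simp [Pi.single_apply, eq_comm]

/-- A proper `K` can be enlarged by some `b` with `(K + A b) / K ≅ A / 𝔪`. The assumption on maps
from `𝔪` supplies a consistent image for `b`, and Noetherian induction climbs up to `⊤`. -/
theorem exists_eq_smul_of_pow_le [IsNoetherianRing A] [h𝔪 : 𝔪.IsMaximal]
    (hext : ∀ g : 𝔪 →ₗ[A] M, ∃ m : M, ∀ x : 𝔪, g x = (x : A) • m)
    {N : ℕ} (K : Ideal A) (hK : 𝔪 ^ N ≤ K) (g : K →ₗ[A] M) :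
    ∃ m : M, ∀ x : K, g x = (x : A) • m := by
  induction K using IsNoetherian.induction with
  | hgt K ih =>
    by_cases htop : K = ⊤
    · subst htop
      exact ⟨g ⟨1, trivial⟩, fun x => by rw [← map_smul]; congr 1; ext; simp⟩
    classical
    have hex : ∃ j, 𝔪 ^ j ≤ K := ⟨N, hK⟩
    obtain ⟨j, hj⟩ : ∃ j, Nat.find hex = j + 1 := by
      refine Nat.exists_eq_succ_of_ne_zero fun h0 => htop ?_
      have := Nat.find_spec hex
      rw [h0] at this
      simpa using this
    have hjle : 𝔪 ^ (j + 1) ≤ K := hj ▸ Nat.find_spec hex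
    -- `b` comes from the last power of `𝔪` not contained in `K`, hence `𝔪 b ⊆ K`.
    obtain ⟨b, hb, hbK⟩ := SetLike.not_le_iff_exists.1 (Nat.find_min hex (m := j) (by omega))
    have hmb : ∀ y ∈ 𝔪, y * b ∈ K := fun y hy => hjle (by
      rw [pow_succ']; exact Ideal.mul_mem_mul hy hb)
    obtain ⟨m, hm⟩ := hext (g ∘ₗ ((LinearMap.mulRight A b).comp 𝔪.subtype).codRestrict K
      fun y => hmb y y.2)
    have hcolon : ∀ c, c * b ∈ K → c ∈ 𝔪 := by
      intro c hc
      by_contra hcm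
      obtain ⟨c', y, hy, h1⟩ := h𝔪.exists_inv hcm
      apply hbK
      have : b = c' * (c * b) + y * b := by rw [← mul_assoc, ← add_mul, h1, one_mul]
      rw [this]
      exact K.add_mem (K.smul_mem c' hc) (hmb y hy)
    obtain ⟨g', hg'⟩ := exists_rangeFactor (K.subtype.coprod (LinearMap.toSpanSingleton A A b))
      (g.coprod (LinearMap.toSpanSingleton A M m)) (by
        rintro ⟨k, c⟩ h
        simp only [LinearMap.coprod_apply, Submodule.coe_subtype, LinearMap.toSpanSingleton_apply,
          smul_eq_mul] at h ⊢
        have hcK : c * b ∈ K := by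
          rw [eq_neg_of_add_eq_zero_right h]; exact K.neg_mem k.2
        have := hm ⟨c, hcolon c hcK⟩
        simp only [LinearMap.comp_apply] at this
        rw [← this, ← map_add]
        convert map_zero g
        ext
        exact h)
    obtain ⟨m', hm'⟩ := ih (LinearMap.range (K.subtype.coprod (LinearMap.toSpanSingleton A A b)))
      (by
        refine lt_of_le_of_ne (fun x hx => ⟨(⟨x, hx⟩, 0), by simp⟩) fun h => hbK ?_
        rw [h]; exact ⟨(0, 1), by simp⟩)
      (fun x hx => ⟨(⟨x, hK hx⟩, 0), by simp⟩) g'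
    refine ⟨m', fun x => ?_⟩
    have h1 := hg' (x, 0)
    have h2 := hm' ⟨_, (x, 0), rfl⟩
    rw [h1] at h2
    simpa using h2

/-- A module over a Noetherian ring, all of whose elements are killed by a power of the maximal
ideal `𝔪`, is injective if every homomorphism from `𝔪` to it extends to the ring. -/
theorem baer_of_powTorsion [IsNoetherianRing A] [𝔪.IsMaximal]
    (htors : ∀ m : M, ∃ k, m ∈ powTorsion 𝔪 M k)
    (hext : ∀ g : 𝔪 →ₗ[A] M, ∃ m : M, ∀ x : 𝔪, g x = (x : A) • m) : Module.Baer A M := by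
  intro I g
  obtain ⟨k, hk⟩ := exists_range_le_powTorsion htors g
  -- Artin–Rees puts `𝔪 ^ (k + l) ⊓ I` inside `𝔪 ^ k * I`, where `g` vanishes; so `g` extends by
  -- zero to `I + 𝔪 ^ (k + l)`.
  obtain ⟨l, hl⟩ := Ideal.exists_pow_inf_eq_pow_smul 𝔪 (I : Submodule A A)
  have hkill : ∀ x : I, (x : A) ∈ 𝔪 ^ (k + l) → g x = 0 := by
    have hle : 𝔪 ^ (k + l) ⊓ I ≤ 𝔪 ^ k * I := by
      have := hl (k + l) (by omega)
      simp only [smul_eq_mul, Ideal.mul_top, Nat.add_sub_cancel] at this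
      rw [this]
      exact Ideal.mul_mono_right inf_le_right
    have key : ∀ z ∈ 𝔪 ^ k * I, ∃ hz : z ∈ I, g ⟨z, hz⟩ = 0 := by
      intro z hz
      refine Submodule.mul_induction_on hz (fun a ha y hy => ⟨I.mul_mem_left a hy, ?_⟩) ?_
      · have := mem_powTorsion.1 (hk ⟨y, hy⟩) a ha
        rwa [← map_smul] at this
      · rintro x y ⟨hx, hx0⟩ ⟨hy, hy0⟩
        refine ⟨I.add_mem hx hy, ?_⟩
        rw [← add_zero (0 : M)]
        nth_rw 1 [← hx0]
        rw [← hy0, ← map_add]; rfl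
    intro x hx
    exact (key x (hle ⟨hx, x.2⟩)).2
  obtain ⟨g', hg'⟩ := exists_rangeFactor (I.subtype.coprod (𝔪 ^ (k + l)).subtype)
    (g.coprod (0 : ((𝔪 ^ (k + l) : Ideal A)) →ₗ[A] M)) (by
      rintro ⟨x, y⟩ h
      simp only [LinearMap.coprod_apply, Submodule.coe_subtype, LinearMap.zero_apply,
        add_zero] at h ⊢
      refine hkill x ?_
      rw [eq_neg_of_add_eq_zero_left h]
      exact Submodule.neg_mem _ y.2)
  obtain ⟨m, hm⟩ := exists_eq_smul_of_pow_le hext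
    (LinearMap.range (I.subtype.coprod (𝔪 ^ (k + l)).subtype)) (N := k + l)
    (fun x hx => ⟨(0, ⟨x, hx⟩), by simp⟩) g'
  refine ⟨LinearMap.toSpanSingleton A M m, fun x hx => ?_⟩
  have h1 := hg' (⟨x, hx⟩, 0)
  have h2 := hm ⟨_, (⟨x, hx⟩, 0), rfl⟩
  rw [h1] at h2
  simpa using h2.symm

end Matlis

/-! ### Derivations and the Euler operator at a closed point -/

section Euler

variable {A : Type} [CommRing A] [Algebra ℂ A]

theorem fn_mul (a b : A) : fn (a * b) = fn a * fn b :=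
  Subtype.ext (LinearMap.ext fun x => mul_assoc a b x)

theorem fn_add (a b : A) : fn (a + b) = fn a + fn b :=
  Subtype.ext (LinearMap.ext fun x => add_mul a b x)

theorem fn_one : fn (1 : A) = 1 :=
  Subtype.ext (LinearMap.ext fun x => one_mul x)

theorem fn_zero : fn (0 : A) = 0 :=
  Subtype.ext (LinearMap.ext fun x => zero_mul x)

/-- A derivation, as a differential operator. -/
def der (δ : Derivation ℂ A A) : D A :=
  ⟨δ.toLinearMap, 1, fun a b => by
    ext x
    simp only [comm, mulOp, LinearMap.sub_apply, LinearMap.comp_apply, LinearMap.mulLeft_apply,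
      AlgHom.id_apply, LinearMap.zero_apply, Derivation.coeFn_coe, Derivation.leibniz,
      smul_eq_mul]
    ring⟩

@[simp] theorem coe_der_apply (δ : Derivation ℂ A A) (b : A) :
    (der δ : Module.End ℂ A) b = δ b := rfl

theorem der_mul_fn (δ : Derivation ℂ A A) (a : A) : der δ * fn a = fn a * der δ + fn (δ a) :=
  Subtype.ext (LinearMap.ext fun x => by
    change δ (a * x) = a * δ x + δ a * x
    rw [Derivation.leibniz, smul_eq_mul, smul_eq_mul, mul_comm x])

theorem derivation_sum_apply {n : ℕ} (δ : Fin n → Derivation ℂ A A) (a : A) :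
    (∑ i, δ i) a = ∑ i, δ i a := by
  rw [← Derivation.coeFnAddMonoidHom_apply, map_sum, Finset.sum_apply]
  rfl

theorem der_sum_smul {n : ℕ} (x : Fin n → A) (δ : Fin n → Derivation ℂ A A) :
    der (∑ i, x i • δ i) = ∑ i, fn (x i) * der (δ i) :=
  Subtype.ext (LinearMap.ext fun b => by
    rw [AddSubmonoidClass.coe_finsetSum, LinearMap.sum_apply, coe_der_apply,
      derivation_sum_apply]
    rfl)

/-- At a maximal ideal `𝔪` of a smooth algebra with generators `x i`, there are derivations `δ i`
for which `∑ x i * δ i` is the identity on `𝔪 / 𝔪 ^ 2`. -/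
theorem exists_derivations [Algebra.FormallySmooth ℂ A] (𝔪 : Ideal A) [Module.Finite A 𝔪]
    (ρ : A →ₐ[ℂ] ℂ) (hρ : ∀ a, ρ a = 0 ↔ a ∈ 𝔪) :
    ∃ (n : ℕ) (x : Fin n → 𝔪) (δ : Fin n → Derivation ℂ A A),
      ∀ y ∈ 𝔪, (∑ i, (x i : A) * δ i y) - y ∈ 𝔪 ^ 2 := by
  obtain ⟨n, f, hf⟩ := Module.Finite.exists_fin' A 𝔪
  have hmem : ∀ a, a - algebraMap ℂ A (ρ a) ∈ 𝔪 := fun a => (hρ _).1 (by simp)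
  let s : A →ₗ[ℂ] 𝔪 := ((LinearMap.id - (Algebra.linearMap ℂ A) ∘ₗ ρ.toLinearMap).codRestrict
    (𝔪.restrictScalars ℂ) hmem)
  have hs : ∀ a, (s a : A) = a - algebraMap ℂ A (ρ a) := fun a => rfl
  -- The differential of `a` at the point. The Leibniz defect is `-(a - ρ a) (b - ρ b)`, which lies
  -- in `𝔪 ^ 2`.
  let d : Derivation ℂ A 𝔪.Cotangent := Derivation.mk'
    ((𝔪.toCotangent.restrictScalars ℂ) ∘ₗ s) fun a b => by
      simp only [LinearMap.comp_apply, LinearMap.restrictScalars_apply]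
      rw [← map_smul 𝔪.toCotangent, ← map_smul 𝔪.toCotangent, ← map_add, Ideal.toCotangent_eq]
      simp only [Submodule.coe_add, Submodule.coe_smul, hs, smul_eq_mul, map_mul]
      have h := Ideal.mul_mem_mul (hmem a) (hmem b)
      rw [← pow_two] at h
      convert (𝔪 ^ 2).neg_mem h using 1
      ring
  -- Kähler differentials of a formally smooth algebra are projective, so `d` lifts to `A ^ n`; the
  -- coordinates of the lift are the `δ i`.
  obtain ⟨h, hh⟩ := Module.projective_lifting_property (𝔪.toCotangent ∘ₗ f)
    d.liftKaehlerDifferential (𝔪.toCotangent_surjective.comp hf)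
  refine ⟨n, fun i => f (Pi.single i 1),
    fun i => ((LinearMap.proj i ∘ₗ h).compDer (KaehlerDifferential.D ℂ A)), fun y hy => ?_⟩
  have h1 := LinearMap.congr_fun hh (KaehlerDifferential.D ℂ A y)
  rw [Derivation.liftKaehlerDifferential_comp_D] at h1
  change 𝔪.toCotangent (f _) = 𝔪.toCotangent (s y) at h1
  rw [Ideal.toCotangent_eq, hs, (hρ y).2 hy, map_zero, sub_zero] at h1
  convert h1 using 2
  rw [LinearMap.pi_apply_eq_sum_univ f, AddSubmonoidClass.coe_finsetSum]
  refine Finset.sum_congr rfl fun i _ => ?_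
  rw [Submodule.coe_smul, smul_eq_mul, mul_comm]
  congr 3
  refine congrArg f (funext fun j => ?_)
  simp [Pi.single_apply, eq_comm]

variable {M : Type} [AddCommGroup M] [Module (D A)ᵐᵒᵖ M] [Module A M]
  {𝔪 : Ideal A} {n : ℕ} {x : Fin n → 𝔪} {δ : Fin n → Derivation ℂ A A}

/-- `der_mul_fn` read in a right module. The plus sign is what makes the Euler eigenvalues
nonnegative. -/
theorem smul_op_der (hA : ∀ (a : A) (m : M), a • m = m <• fn a) (δ : Derivation ℂ A A) (y : A)
    (m : M) : y • (m <• der δ) = (y • m) <• der δ + δ y • m := by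
  simp only [hA]
  rw [smul_smul, smul_smul, ← MulOpposite.op_mul, ← MulOpposite.op_mul, der_mul_fn,
    MulOpposite.op_add, add_smul]

theorem op_euler (hA : ∀ (a : A) (m : M), a • m = m <• fn a) (m : M) :
    m <• der (∑ i, (x i : A) • δ i) = ∑ i, ((x i : A) • m) <• der (δ i) := by
  rw [der_sum_smul, Finset.op_sum, Finset.sum_smul]
  refine Finset.sum_congr rfl fun i _ => ?_
  rw [hA, smul_smul, ← MulOpposite.op_mul]

/-- The Euler operator acts on the successive quotients of the filtration by `powTorsion` through
integers. -/
theorem op_euler_sub_mem (hA : ∀ (a : A) (m : M), a • m = m <• fn a)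
    (hδ : ∀ y ∈ 𝔪, (∑ i, (x i : A) * δ i y) - y ∈ 𝔪 ^ 2) (k : ℕ) {m : M}
    (hm : m ∈ powTorsion 𝔪 M (k + 1)) :
    m <• der (∑ i, (x i : A) • δ i) - (k : A) • m ∈ powTorsion 𝔪 M k := by
  induction k generalizing m with
  | zero =>
    rw [op_euler hA, Finset.sum_eq_zero fun i _ => ?_]
    · simp
    · rw [mem_powTorsion.1 hm (x i) (by simp), smul_zero]
  | succ k ih =>
    refine mem_powTorsion_succ fun y hy => ?_
    have hy1 : y ∈ 𝔪 ^ 1 := by simpa using hy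
    -- Moving `y` past the Euler operator adds its value on `y`, which is `y` modulo `𝔪 ^ 2`; this
    -- raises the eigenvalue from `k` to `k + 1`.
    have h1 := ih (smul_mem_powTorsion hy1 hm)
    have h2 := smul_mem_powTorsion (k := k) (hδ y hy) hm
    convert Submodule.add_mem _ h1 h2 using 1
    rw [smul_sub, smul_op_der hA, sub_smul, derivation_sum_apply]
    simp only [Derivation.smul_apply, smul_eq_mul, Nat.cast_succ, add_smul, one_smul, smul_add,
      smul_comm y]
    abel

/-- The Poincaré lemma for a right `D A`-module supported at a closed point. -/
theorem exists_eq_smul_of_range_le (hA : ∀ (a : A) (m : M), a • m = m <• fn a)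
    (hδ : ∀ y ∈ 𝔪, (∑ i, (x i : A) * δ i y) - y ∈ 𝔪 ^ 2) (k : ℕ) (g : 𝔪 →ₗ[A] M)
    (hg : ∀ y, g y ∈ powTorsion 𝔪 M k) : ∃ m : M, ∀ y : 𝔪, g y = (y : A) • m := by
  induction k generalizing g with
  | zero => exact ⟨0, fun y => by rw [eq_zero_of_mem_powTorsion_zero (hg y), smul_zero]⟩
  | succ k ih =>
    have hsq : ∀ z ∈ 𝔪 ^ 2, ∃ hz : z ∈ 𝔪, g ⟨z, hz⟩ ∈ powTorsion 𝔪 M k := by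
      intro z hz
      rw [pow_two] at hz
      refine Submodule.mul_induction_on hz (fun a ha b hb => ⟨𝔪.mul_mem_left a hb, ?_⟩) ?_
      · have := smul_mem_powTorsion (j := 1) (by simpa using ha) (hg ⟨b, hb⟩)
        rwa [← map_smul] at this
      · rintro a b ⟨ha, ha'⟩ ⟨hb, hb'⟩
        exact ⟨𝔪.add_mem ha hb, by
          have := Submodule.add_mem _ ha' hb'
          rwa [← map_add] at this⟩
    -- With `E` the Euler derivation, `y • m₀ = g y <• E + g (E y)`. Modulo lower torsion the first
    -- term is `k • g y` and the second is `g y`.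
    let m₀ : M := ∑ i, (g (x i)) <• der (δ i)
    have key : ∀ y : 𝔪, (y : A) • m₀ - ((k + 1 : ℕ) : A) • g y ∈ powTorsion 𝔪 M k := by
      intro y
      obtain ⟨hz, hz'⟩ := hsq _ (hδ y y.2)
      convert Submodule.add_mem _ (op_euler_sub_mem hA hδ k (hg y)) hz' using 1
      have e1 : g ⟨_, hz⟩ = (∑ i, δ i y • g (x i)) - g y := by
        simp only [← map_smul, ← map_sum, ← map_sub]
        congr 1
        ext
        simp [mul_comm]
      rw [e1, op_euler hA, Finset.smul_sum]
      simp only [smul_op_der hA, Finset.sum_add_distrib]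
      have e2 : ∀ i, (y : A) • g (x i) = (x i : A) • g y := fun i => by
        rw [← map_smul, ← map_smul]
        congr 1
        ext
        simp [mul_comm]
      simp only [e2, Nat.cast_succ, add_smul, one_smul]
      abel
    -- Characteristic zero enters here. Subtracting the map given by `c • m₀` pushes the values of
    -- `g` down one level.
    let c : A := algebraMap ℂ A ((k + 1 : ℕ) : ℂ)⁻¹
    have hc : c * ((k + 1 : ℕ) : A) = 1 := by
      rw [← map_natCast (algebraMap ℂ A), ← map_mul, inv_mul_cancel₀ (by exact_mod_cast k.succ_ne_zero),
        map_one]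
    obtain ⟨m, hm⟩ := ih (g - (LinearMap.toSpanSingleton A M (c • m₀)) ∘ₗ 𝔪.subtype) fun y => by
      have := Submodule.neg_mem _ (Submodule.smul_mem _ c (key y))
      convert this using 1
      rw [smul_sub, smul_smul c (_ : A) (g y), hc, one_smul, neg_sub]
      simp [smul_comm c]
    refine ⟨m + c • m₀, fun y => ?_⟩
    rw [smul_add, ← hm y]
    simp

end Euler

/-- A right `D`-module supported at a point of a smooth affine variety is injective over the
functions. -/
theorem baer_of_supp_subsingleton {A : Type} [CommRing A] [Algebra ℂ A] [Algebra.Smooth ℂ A]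
    {M : Type} [AddCommGroup M] [Module (D A)ᵐᵒᵖ M] [Module A M]
    (hA : ∀ (a : A) (m : M), a • m = m <• fn a) (hM : (supp A M).Subsingleton) :
    Module.Baer A M := by
  have : IsNoetherianRing A := Algebra.FiniteType.isNoetherianRing ℂ A
  have hsupp : ∀ (m : M) (p : PrimeSpectrum A), Ideal.torsionOf A M m ≤ p.asIdeal →
      p ∈ supp A M := fun m p h => ⟨m, fun a ha h0 => ha (h (by
        rw [Ideal.mem_torsionOf_iff, hA]; exact h0))⟩
  by_cases htriv : ∀ m : M, m = 0
  · exact fun I g => ⟨0, fun x hx => by rw [htriv (g _)]; rfl⟩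
  push Not at htriv
  obtain ⟨m₀, hm₀⟩ := htriv
  have hne : ∀ m : M, m ≠ 0 → Ideal.torsionOf A M m ≠ ⊤ := fun m hm h => hm
    ((Ideal.torsionOf_eq_top_iff _ _).1 h)
  -- Every prime containing the annihilator of an element lies in the support, so the only point of
  -- the support is closed.
  obtain ⟨𝔪, h𝔪, hle⟩ := Ideal.exists_le_maximal _ (hne m₀ hm₀)
  have huniq : ∀ p ∈ supp A M, p.asIdeal = 𝔪 := fun p hp =>
    congrArg PrimeSpectrum.asIdeal (hM hp (hsupp m₀ ⟨𝔪, h𝔪.isPrime⟩ hle))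
  have htors : ∀ m : M, ∃ k, m ∈ powTorsion 𝔪 M k := by
    intro m
    have hrad : 𝔪 ≤ (Ideal.torsionOf A M m).radical := by
      rw [Ideal.radical_eq_sInf]
      exact le_sInf fun p ⟨hp, hpr⟩ => (huniq ⟨p, hpr⟩ (hsupp m ⟨p, hpr⟩ hp)).ge
    obtain ⟨k, hk⟩ := Ideal.exists_pow_le_of_le_radical_of_fg hrad (IsNoetherian.noetherian 𝔪)
    exact ⟨k, mem_powTorsion.2 fun a ha => (Ideal.mem_torsionOf_iff _ _).1 (hk ha)⟩
  let _ : Field (A ⧸ 𝔪) := Ideal.Quotient.field 𝔪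
  -- Nullstellensatz: the residue field is `ℂ`, which provides the evaluation `ρ`.
  have : Module.Finite ℂ (A ⧸ 𝔪) := finite_of_finite_type_of_isJacobsonRing ℂ (A ⧸ 𝔪)
  have hbij : Function.Bijective (Algebra.ofId ℂ (A ⧸ 𝔪)) :=
    IsAlgClosed.algebraMap_bijective_of_isIntegral
  let e := AlgEquiv.ofBijective _ hbij
  obtain ⟨n, x, δ, hδ⟩ := exists_derivations 𝔪
    (e.symm.toAlgHom.comp (Ideal.Quotient.mkₐ ℂ 𝔪)) (fun a => by
      simp [Ideal.Quotient.eq_zero_iff_mem])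
  refine baer_of_powTorsion htors fun g => ?_
  obtain ⟨k, hk⟩ := exists_range_le_powTorsion htors g
  exact exists_eq_smul_of_range_le hA hδ k g hk

/-! ### Differential operators on a smooth algebra form a projective left module -/

section Taylor

variable {A : Type} [CommRing A] [Algebra ℂ A]

/-- The map `a ⊗ b ↦ a * T b`. -/
def leftExt (T : A →ₗ[ℂ] A) : A ⊗[ℂ] A →ₗ[ℂ] A := LinearMap.mul' ℂ A ∘ₗ T.lTensor A

@[simp] theorem leftExt_tmul (T : A →ₗ[ℂ] A) (a b : A) : leftExt T (a ⊗ₜ b) = a * T b := by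
  simp [leftExt]

theorem leftExt_tmul_mul (T : A →ₗ[ℂ] A) (a : A) (z : A ⊗[ℂ] A) :
    leftExt T (a ⊗ₜ 1 * z) = a * leftExt T z := by
  induction z using TensorProduct.induction_on with
  | zero => simp
  | tmul b c => simp [mul_assoc]
  | add x y hx hy => rw [mul_add, map_add, map_add, hx, hy, mul_add]

/-- This turns the order condition into vanishing on powers of the diagonal ideal, which the
elements `1 ⊗ a - a ⊗ 1` generate. -/
theorem leftExt_comm (T : A →ₗ[ℂ] A) (a : A) (z : A ⊗[ℂ] A) :
    leftExt (comm (AlgHom.id ℂ A) T a) z = leftExt T ((1 ⊗ₜ a - a ⊗ₜ 1) * z) := by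
  induction z using TensorProduct.induction_on with
  | zero => simp
  | tmul b c => simp [comm, mulOp, sub_mul]; ring
  | add x y hx hy => rw [mul_add, map_add, map_add, hx, hy]

/-- A differential operator of order `≤ n` factors through the `n`-th principal parts. -/
theorem IsDiffOp.leftExt_eq_zero {n : ℕ} {T : A →ₗ[ℂ] A} (hT : IsDiffOp (AlgHom.id ℂ A) n T)
    {z : A ⊗[ℂ] A} (hz : z ∈ KaehlerDifferential.ideal ℂ A ^ (n + 1)) : leftExt T z = 0 := by
  have step : ∀ (T : A →ₗ[ℂ] A) (J : Ideal (A ⊗[ℂ] A)),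
      (∀ a, ∀ w ∈ J, leftExt (comm (AlgHom.id ℂ A) T a) w = 0) →
      ∀ z ∈ KaehlerDifferential.ideal ℂ A * J, leftExt T z = 0 := by
    intro T J h z hz
    refine Submodule.mul_induction_on hz (fun x hx w hw => ?_) fun x y hx hy => by
      rw [map_add, hx, hy, add_zero]
    rw [← KaehlerDifferential.span_range_eq_ideal] at hx
    induction hx using Submodule.span_induction generalizing w with
    | mem x hx =>
      obtain ⟨a, rfl⟩ := hx
      rw [← leftExt_comm]
      exact h a w hw
    | zero => simp
    | add x y _ _ hx hy => rw [add_mul, map_add, hx w hw, hy w hw, add_zero]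
    | smul r x _ hx =>
      rw [smul_eq_mul, mul_comm r x, mul_assoc]
      exact hx _ (J.mul_mem_left r hw)
  induction n generalizing T z with
  | zero =>
    refine step T ⊤ (fun a w _ => ?_) z (by simpa using hz)
    rw [hT a]
    simp [leftExt]
  | succ n ih =>
    rw [pow_succ'] at hz
    exact step T _ (fun a w hw => ih (hT a) hw) z hz

/-- If `τ` is a homomorphism to an augmented algebra which splits the augmentation, and `L` is a
linear form which vanishes on a power of the augmentation ideal, then `L ∘ τ` is a differential
operator. -/
theorem isDiffOp_comp_of_vanish {B : Type} [CommRing B] [Algebra A B] [Algebra ℂ B]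
    [IsScalarTower ℂ A B] (τ : A →ₐ[ℂ] B) (𝔫 : Ideal B)
    (hτ : ∀ a, τ a - algebraMap A B a ∈ 𝔫) (k : ℕ) (L : B →ₗ[A] A)
    (hL : ∀ b ∈ 𝔫 ^ (k + 1), L b = 0) :
    IsDiffOp (AlgHom.id ℂ A) k (L.restrictScalars ℂ ∘ₗ τ.toLinearMap) := by
  -- Each commutator inserts a factor `τ a - a ∈ 𝔫` under `L`; after `k + 1` of them the argument is
  -- in `𝔫 ^ (k + 1)`.
  have hcomm : ∀ (L : B →ₗ[A] A) (a : A), comm (AlgHom.id ℂ A) (L.restrictScalars ℂ ∘ₗ τ.toLinearMap) a =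
      (L ∘ₗ LinearMap.mulLeft A (τ a - algebraMap A B a)).restrictScalars ℂ ∘ₗ
        τ.toLinearMap := by
    intro L a
    ext x
    simp [comm, mulOp, sub_mul, ← Algebra.smul_def]
  induction k generalizing L with
  | zero =>
    intro a
    rw [hcomm]
    ext x
    exact hL _ (by simpa using 𝔫.mul_mem_right _ (hτ a))
  | succ k ih =>
    intro a
    rw [hcomm]
    exact ih _ (fun b hb => hL _ (by rw [pow_succ']; exact Ideal.mul_mem_mul (hτ a) hb))

/-- Differential operators of order `≤ n` have a finite dual basis over the functions. -/
theorem exists_dualBasis [Algebra.Smooth ℂ A] (n : ℕ) :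
    ∃ (ι : Type) (_ : Fintype ι) (z : ι → A ⊗[ℂ] A) (e : ι → D A),
      ∀ T : D A, IsDiffOp (AlgHom.id ℂ A) n T.1 →
        T = ∑ j, fn (leftExt T.1 (z j)) * e j := by
  obtain ⟨N, π, hπ⟩ := Algebra.FiniteType.iff_quotient_mvPolynomial''.1
    (inferInstance : Algebra.FiniteType ℂ A)
  let J := KaehlerDifferential.ideal ℂ A
  let P := (A ⊗[ℂ] A) ⧸ J ^ (n + 1)
  let x : Fin N → A := fun i => π (MvPolynomial.X i)
  let R := MvPolynomial (Fin N) A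
  let 𝔫 := MvPolynomial.idealOfVars (Fin N) A
  -- The variables stand for the Taylor increments of the generators `x i`.
  let s₀ : R →ₐ[A] A ⊗[ℂ] A := MvPolynomial.aeval fun i => 1 ⊗ₜ x i - x i ⊗ₜ 1
  let fin : Fintype {α : Fin N →₀ ℕ // α.degree ≤ n} := (Finsupp.finite_of_degree_le n).fintype
  have hs₀X : ∀ i, s₀ (MvPolynomial.X i) = 1 ⊗ₜ x i - x i ⊗ₜ 1 := fun i =>
    MvPolynomial.aeval_X _ i
  have hs₀C : ∀ a, s₀ (MvPolynomial.C a) = a ⊗ₜ 1 := fun a => s₀.commutes a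
  have hs₀ : 𝔫 ≤ J.comap s₀ := by
    refine Ideal.span_le.2 ?_
    rintro _ ⟨i, rfl⟩
    change s₀ (MvPolynomial.X i) ∈ J
    rw [hs₀X]
    exact KaehlerDifferential.one_smul_sub_smul_one_mem_ideal ℂ (x i)
  have hs₀n : ∀ r ∈ 𝔫 ^ (n + 1), s₀ r ∈ J ^ (n + 1) := fun r hr =>
    (Ideal.pow_right_mono hs₀ _).trans (Ideal.le_comap_pow _ _) hr
  have haug : ∀ r, s₀ r ∈ J → r ∈ 𝔫 := by
    intro r hr
    -- Restricting to the diagonal sets all increments to zero, so only the constant term of `r`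
    -- survives.
    have h1 : (Algebra.TensorProduct.lmul'' ℂ (S := A)).comp s₀ = MvPolynomial.aeval 0 := by
      ext i
      simp only [AlgHom.comp_apply, hs₀X, MvPolynomial.aeval_X, Pi.zero_apply, map_sub]
      exact sub_eq_zero.2 ((one_mul (x i)).trans (mul_one (x i)).symm)
    have h2 : MvPolynomial.aeval (0 : Fin N → A) r = 0 := by
      rw [← h1]
      exact hr
    rw [MvPolynomial.aeval_zero] at h2
    rw [← pow_one 𝔫, MvPolynomial.mem_pow_idealOfVars_iff']
    intro α hα
    obtain rfl : α = 0 := (Finsupp.degree_eq_zero_iff α).1 (by simpa using hα)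
    exact h2
  have hs₀surj : Function.Surjective s₀ := by
    intro w
    induction w using TensorProduct.induction_on with
    | zero => exact ⟨0, map_zero _⟩
    | add u v hu hv =>
      obtain ⟨u, rfl⟩ := hu
      obtain ⟨v, rfl⟩ := hv
      exact ⟨u + v, map_add _ _ _⟩
    | tmul a b =>
      obtain ⟨f, rfl⟩ := hπ b
      -- The Taylor shift `f(X + x)`, which `s₀` sends to `1 ⊗ f(x)`.
      let φ : MvPolynomial (Fin N) ℂ →ₐ[ℂ] R :=
        MvPolynomial.aeval fun i => MvPolynomial.X i + MvPolynomial.C (x i)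
      have h : (s₀.restrictScalars ℂ).comp φ =
          (Algebra.TensorProduct.includeRight).comp π := by
        ext i
        simp only [AlgHom.comp_apply, φ, MvPolynomial.aeval_X, AlgHom.restrictScalars_apply, map_add,
          hs₀X, hs₀C, Algebra.TensorProduct.includeRight_apply]
        exact sub_add_cancel _ _
      refine ⟨a • φ f, ?_⟩
      rw [map_smul]
      have := AlgHom.congr_fun h f
      simp only [AlgHom.comp_apply, AlgHom.restrictScalars_apply,
        Algebra.TensorProduct.includeRight_apply] at this
      rw [this, TensorProduct.smul_tmul', smul_eq_mul, mul_one]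
  let B := R ⧸ 𝔫 ^ (n + 1)
  let σ : B →ₐ[A] P := Ideal.quotientMapₐ _ s₀ hs₀n
  have hσ : Function.Surjective σ := by
    intro w
    obtain ⟨w, rfl⟩ := Ideal.Quotient.mk_surjective w
    obtain ⟨r, rfl⟩ := hs₀surj w
    exact ⟨Ideal.Quotient.mk _ r, rfl⟩
  let 𝔫' : Ideal B := 𝔫.map (Ideal.Quotient.mk (𝔫 ^ (n + 1)))
  have h𝔫' : 𝔫' ^ (n + 1) = ⊥ := by
    rw [← Ideal.map_pow, Ideal.map_quotient_self]
  have hσmk : ∀ r, σ (Ideal.Quotient.mk _ r) = Ideal.Quotient.mk _ (s₀ r) := fun r => rfl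
  have hJ : J ^ (n + 1) ≤ J := Ideal.pow_le_self (by omega)
  have hnil : IsNilpotent (RingHom.ker (σ.restrictScalars ℂ : B →+* P)) := by
    refine ⟨n + 1, le_bot_iff.1 (le_trans (Ideal.pow_right_mono (fun b hb => ?_) _) h𝔫'.le)⟩
    obtain ⟨r, rfl⟩ := Ideal.Quotient.mk_surjective b
    exact Ideal.mem_map_of_mem _ (haug r (hJ (Ideal.Quotient.eq_zero_iff_mem.1 hb)))
  -- `σ` has nilpotent kernel, so formal smoothness gives every `a` a truncated Taylor expansion `τ
  -- a`, multiplicatively in `a`.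
  let τ : A →ₐ[ℂ] B := Algebra.FormallySmooth.liftOfSurjective
    ((Ideal.Quotient.mkₐ ℂ (J ^ (n + 1))).comp Algebra.TensorProduct.includeRight)
    (σ.restrictScalars ℂ) hσ hnil
  have hτσ : ∀ a, σ (τ a) = Ideal.Quotient.mk _ (1 ⊗ₜ a) := fun a =>
    Algebra.FormallySmooth.liftOfSurjective_apply _ (σ.restrictScalars ℂ) hσ hnil a
  have hτ : ∀ a, τ a - algebraMap A B a ∈ 𝔫' := by
    intro a
    obtain ⟨r, hr⟩ := Ideal.Quotient.mk_surjective (τ a - algebraMap A B a)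
    rw [← hr]
    refine Ideal.mem_map_of_mem _ (haug r ?_)
    have h : Ideal.Quotient.mk (J ^ (n + 1)) (s₀ r) =
        Ideal.Quotient.mk _ (1 ⊗ₜ a - a ⊗ₜ 1) := by
      rw [← hσmk, hr, map_sub, hτσ, AlgHom.commutes, map_sub]
      rfl
    have h2 := J.add_mem (hJ (Ideal.Quotient.eq.1 h))
      (KaehlerDifferential.one_smul_sub_smul_one_mem_ideal ℂ a)
    rwa [sub_add_cancel] at h2
  let L : {α : Fin N →₀ ℕ // α.degree ≤ n} → B →ₗ[A] A := fun α =>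
    ((𝔫 ^ (n + 1)).restrictScalars A).liftQ (MvPolynomial.lcoeff A α.1) (fun r hr =>
      (MvPolynomial.mem_pow_idealOfVars_iff' _ _).1 hr α.1 (Nat.lt_succ_of_le α.2)) ∘ₗ
    (Submodule.Quotient.restrictScalarsEquiv A (𝔫 ^ (n + 1))).symm.toLinearMap
  have hL : ∀ α r, L α (Ideal.Quotient.mk _ r) = MvPolynomial.coeff α.1 r := fun α r => rfl
  refine ⟨{α : Fin N →₀ ℕ // α.degree ≤ n}, fin, fun α => s₀ (MvPolynomial.monomial α.1 1),
    fun α => ⟨(L α).restrictScalars ℂ ∘ₗ τ.toLinearMap, n,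
      isDiffOp_comp_of_vanish τ 𝔫' hτ n (L α) fun b hb => by
        rw [h𝔫'] at hb
        rw [(Submodule.mem_bot B).1 hb, map_zero]⟩, fun T hT => ?_⟩
  refine Subtype.ext (LinearMap.ext fun a => ?_)
  obtain ⟨r, hr⟩ := Ideal.Quotient.mk_surjective (τ a)
  rw [AddSubmonoidClass.coe_finsetSum, LinearMap.sum_apply]
  change T.1 a = ∑ α, leftExt T.1 (s₀ (MvPolynomial.monomial α.1 1)) * L α (τ a)
  simp only [← hr, hL]
  -- `T` sees `1 ⊗ a` only modulo `J ^ (n + 1)`, where it agrees with `s₀ t` for the truncation `t`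
  -- of `r`.
  have h1 : s₀ r - 1 ⊗ₜ a ∈ J ^ (n + 1) := by
    rw [← Ideal.Quotient.eq, ← hσmk, hr, hτσ]
  let t : R := ∑ α : {α : Fin N →₀ ℕ // α.degree ≤ n},
    MvPolynomial.coeff α.1 r • MvPolynomial.monomial α.1 1
  have h2 : r - t ∈ 𝔫 ^ (n + 1) := by
    rw [MvPolynomial.mem_pow_idealOfVars_iff']
    intro α hα
    rw [MvPolynomial.coeff_sub, MvPolynomial.coeff_sum,
      Finset.sum_eq_single ⟨α, Nat.le_of_lt_succ hα⟩]
    · rw [sub_eq_zero, MvPolynomial.coeff_smul, MvPolynomial.coeff_monomial, if_pos rfl,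
        smul_eq_mul, mul_one]
    · intro β _ hβ
      rw [MvPolynomial.coeff_smul, MvPolynomial.coeff_monomial,
        if_neg fun h => hβ (Subtype.ext h), smul_zero]
    · simp
  have h3 := hT.leftExt_eq_zero ((J ^ (n + 1)).sub_mem (hs₀n _ h2) h1)
  have h4 : leftExt T.1 (s₀ t) = T.1 a := by
    have h5 : s₀ (r - t) - (s₀ r - 1 ⊗ₜ a) = 1 ⊗ₜ a - s₀ t := by rw [map_sub]; ring
    rw [h5, map_sub, sub_eq_zero, leftExt_tmul, one_mul] at h3
    exact h3.symm
  rw [← h4, map_sum, map_sum]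
  refine Finset.sum_congr rfl fun α _ => ?_
  rw [map_smul, Algebra.smul_def, Algebra.TensorProduct.algebraMap_apply, leftExt_tmul_mul,
    mul_comm]
  rfl

end Taylor

/-! ### Vanishing of `Ext` -/

section Ext

variable {A R : Type} [CommRing A] [Ring R] {φ : A →+* R}

/-- The equational criterion for the flatness of `R` as a left `A`-module through `φ`. -/
def EquationallyFlat (φ : A →+* R) : Prop :=
  ∀ (κ : Type) (s : Finset κ) (a : κ → A) (d : κ → R), ∑ k ∈ s, φ (a k) * d k = 0 →
    ∃ (ι : Type) (_ : Fintype ι) (b : ι → κ → A) (e : ι → R),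
      (∀ k ∈ s, d k = ∑ j, φ (b j k) * e j) ∧ ∀ j, ∑ k ∈ s, a k * b j k = 0

/-- An injective right module over a left flat extension of `A` is injective over `A`. -/
theorem EquationallyFlat.baer_of_injective (hφ : EquationallyFlat φ) {J : Type} [AddCommGroup J]
    [Module Rᵐᵒᵖ J] [Module A J] (hA : ∀ (a : A) (m : J), a • m = m <• φ a)
    [Module.Injective Rᵐᵒᵖ J] : Module.Baer A J := by
  intro I g
  let f : (I →₀ Rᵐᵒᵖ) →ₗ[Rᵐᵒᵖ] Rᵐᵒᵖ :=
    Finsupp.linearCombination _ fun a : I => MulOpposite.op (φ a)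
  let G : (I →₀ Rᵐᵒᵖ) →ₗ[Rᵐᵒᵖ] J := Finsupp.linearCombination _ g
  -- This is the injectivity of `I ⊗ R → R`: it makes `g` extend to the right ideal generated by `φ
  -- '' I`, and then to `R` by injectivity of `J`.
  have hfG : ∀ c, f c = 0 → G c = 0 := by
    intro c hc
    obtain ⟨ι, _, b, e, hd, hb⟩ := hφ _ c.support (fun a : I => (a : A)) (fun a => (c a).unop) (by
      have := congrArg MulOpposite.unop hc
      simpa [f, Finsupp.linearCombination_apply, Finsupp.sum] using this)
    have hG : G c = ∑ a ∈ c.support, g a <• (c a).unop := by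
      simp [G, Finsupp.linearCombination_apply, Finsupp.sum]
    rw [hG]
    calc ∑ a ∈ c.support, g a <• (c a).unop
        = ∑ a ∈ c.support, ∑ j, (b j a • g a) <• e j := by
          refine Finset.sum_congr rfl fun a ha => ?_
          rw [hd a ha, Finset.op_sum, Finset.sum_smul]
          refine Finset.sum_congr rfl fun j _ => ?_
          rw [hA, smul_smul, ← MulOpposite.op_mul]
      _ = ∑ j, g (∑ a ∈ c.support, b j a • a) <• e j := by
          rw [Finset.sum_comm]
          refine Finset.sum_congr rfl fun j _ => ?_
          rw [← Finset.smul_sum, map_sum]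
          simp only [map_smul]
      _ = 0 := by
          refine Finset.sum_eq_zero fun j _ => ?_
          have : ∑ a ∈ c.support, b j a • a = 0 := by
            ext
            simpa [mul_comm] using hb j
          rw [this, map_zero, smul_zero]
  obtain ⟨k, hk⟩ := exists_rangeFactor f G hfG
  obtain ⟨h, hh⟩ := Module.Injective.out (LinearMap.range f).subtype
    (Submodule.subtype_injective _) k
  refine ⟨LinearMap.toSpanSingleton A J (h 1), fun x hx => ?_⟩
  have h1 := hk (Finsupp.single ⟨x, hx⟩ 1)
  rw [← hh] at h1
  simp only [f, G, Finsupp.linearCombination_single, one_smul, Submodule.subtype_apply] at h1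
  rw [← h1, LinearMap.toSpanSingleton_apply, hA, ← map_smul]
  simp

/-- The `A`-module underlying a right `R`-module. -/
abbrev restrictRight (φ : A →+* R) (M : Type) [AddCommGroup M] [Module Rᵐᵒᵖ M] : Module A M :=
  Module.compHom M
    ({ toFun := fun a => MulOpposite.op (φ a)
       map_one' := by simp
       map_mul' := fun a b => by rw [mul_comm, map_mul, MulOpposite.op_mul]
       map_zero' := by simp
       map_add' := by simp } : A →+* Rᵐᵒᵖ)

/-- Homomorphisms from the cyclic module of an ideal `I` of `A` to the quotient of `J` by an
`A`-injective submodule lift to `J`. -/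
theorem exists_lift_of_baer {I : Ideal A} {M J Q : Type} [AddCommGroup M] [AddCommGroup J]
    [AddCommGroup Q] [Module Rᵐᵒᵖ M] [Module Rᵐᵒᵖ J] [Module Rᵐᵒᵖ Q] [Module A M] [Module A J]
    (hA : ∀ (a : A) (m : M), a • m = m <• φ a) (hAJ : ∀ (a : A) (m : J), a • m = m <• φ a)
    (hM : Module.Baer A M)
    (i : M →ₗ[Rᵐᵒᵖ] J) (p : J →ₗ[Rᵐᵒᵖ] Q) (hi : Function.Injective i)
    (hip : Function.Exact i p) (hp : Function.Surjective p)
    (y : (R ⧸ Submodule.span Rᵐᵒᵖ (φ '' (I : Set A))) →ₗ[Rᵐᵒᵖ] Q) :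
    ∃ w : (R ⧸ Submodule.span Rᵐᵒᵖ (φ '' (I : Set A))) →ₗ[Rᵐᵒᵖ] J, p ∘ₗ w = y := by
  let i' : M →ₗ[A] J :=
    { i with
      map_smul' := fun a m => by
        rw [RingHom.id_apply, hA, hAJ]; exact i.map_smul _ _ }
  have := hM.injective
  obtain ⟨r, hr⟩ := Module.Injective.out i' hi (LinearMap.id : M →ₗ[A] M)
  let S : Submodule Rᵐᵒᵖ R := Submodule.span Rᵐᵒᵖ (φ '' (I : Set A))
  obtain ⟨j₀, hj₀⟩ := hp (y (S.mkQ 1))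
  have hker : ∀ a ∈ I, ∃ m, i m = a • j₀ := by
    intro a ha
    refine (hip _).1 ?_
    have h0 : MulOpposite.op (φ a) • S.mkQ 1 = 0 := by
      rw [← map_smul, ← LinearMap.mem_ker, Submodule.ker_mkQ]
      refine Submodule.subset_span ⟨a, ha, ?_⟩
      simp
    rw [hAJ, map_smul, hj₀, ← map_smul, h0, map_zero]
  -- For `a ∈ I`, `a • j₀` lies in the image of `i`, on which `i ∘ r` is the identity. The corrected
  -- element still lifts `y 1`.
  have hj : ∀ a ∈ I, a • (j₀ - i' (r j₀)) = 0 := by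
    intro a ha
    obtain ⟨m, hm⟩ := hker a ha
    have h1 : a • i' (r j₀) = i' (r (a • j₀)) := by rw [map_smul, map_smul]
    rw [smul_sub, h1, ← hm]
    change i' m - i' (r (i' m)) = 0
    rw [hr, LinearMap.id_apply, sub_self]
  let w₀ : R →ₗ[Rᵐᵒᵖ] J :=
    { toFun := fun P => (j₀ - i' (r j₀)) <• P
      map_add' := fun P Q => by rw [MulOpposite.op_add, add_smul]
      map_smul' := fun P Q => by
        rw [RingHom.id_apply, smul_smul, MulOpposite.smul_eq_mul_unop, MulOpposite.op_mul,
          MulOpposite.op_unop] }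
  refine ⟨S.liftQ w₀ (Submodule.span_le.2 ?_), ?_⟩
  · rintro _ ⟨a, ha, rfl⟩
    exact (hAJ a _).symm.trans (hj a ha)
  · refine Submodule.linearMap_qext _ (LinearMap.ext fun P => ?_)
    change p ((j₀ - i (r j₀)) <• P) = y (S.mkQ P)
    rw [map_smul, map_sub, hip.apply_apply_eq_zero, sub_zero, hj₀, ← map_smul, ← map_smul]
    simp

/-- The sequence splits because `M` is injective, so `Q` is a direct summand of `J`. -/
theorem baer_of_exact {M J Q : Type} [AddCommGroup M] [AddCommGroup J] [AddCommGroup Q]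
    [Module A M] [Module A J] [Module A Q] (hM : Module.Baer A M) (hJ : Module.Baer A J)
    (i : M →ₗ[A] J) (p : J →ₗ[A] Q) (hi : Function.Injective i) (hip : Function.Exact i p)
    (hp : Function.Surjective p) : Module.Baer A Q := by
  have := hM.injective
  obtain ⟨r, hr⟩ := Module.Injective.out i hi (LinearMap.id : M →ₗ[A] M)
  obtain ⟨k, hk⟩ := exists_rangeFactor p (LinearMap.id - i ∘ₗ r) fun x hx => by
    obtain ⟨m, rfl⟩ := (hip x).1 hx
    simp [hr]
  intro I g
  obtain ⟨g', hg'⟩ := hJ I (k ∘ₗ g.codRestrict (LinearMap.range p) fun x => hp (g x))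
  refine ⟨p ∘ₗ g', fun x hx => ?_⟩
  obtain ⟨j, hj⟩ := hp (g ⟨x, hx⟩)
  have h1 : g.codRestrict (LinearMap.range p) (fun x => hp (g x)) ⟨x, hx⟩ = ⟨p j, j, rfl⟩ :=
    Subtype.ext hj.symm
  rw [LinearMap.comp_apply, hg' x hx, LinearMap.comp_apply, h1, hk, LinearMap.sub_apply, map_sub,
    LinearMap.comp_apply, hip.apply_apply_eq_zero, sub_zero, ← hj]
  rfl

/-- The groups `Ext` from the cyclic module of an ideal of `A` to an `A`-injective module vanish. -/
theorem EquationallyFlat.subsingleton_ext (hφ : EquationallyFlat φ) (I : Ideal A) (n : ℕ)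
    (M : ModuleCat.{0} Rᵐᵒᵖ) (hM : letI := restrictRight φ M; Module.Baer A M) :
    Subsingleton (Abelian.Ext (cyclicRight (φ '' (I : Set A))) M (n + 1)) := by
  refine subsingleton_of_forall_eq 0 fun x => ?_
  induction n generalizing M with
  | zero =>
    let S := ShortComplex.mk (Injective.ι M) (Limits.cokernel.π (Injective.ι M)) (by simp)
    have hS : S.ShortExact := { exact := ShortComplex.exact_cokernel _ }
    obtain ⟨y, hy⟩ := Abelian.Ext.covariant_sequence_exact₁ _ hS x
      (Abelian.Ext.eq_zero_of_injective _) (zero_add 1)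
    let := restrictRight φ M
    let := restrictRight φ S.X₂
    obtain ⟨w, hw⟩ := exists_lift_of_baer (φ := φ) (I := I) (fun _ _ => rfl) (fun _ _ => rfl) hM
      S.f.hom S.g.hom ((ModuleCat.mono_iff_injective _).1 hS.mono_f)
      ((ShortComplex.ShortExact.moduleCat_exact_iff_function_exact S).1 hS.exact)
      ((ModuleCat.epi_iff_surjective _).1 hS.epi_g) (Abelian.Ext.homEquiv₀ y).hom
    have hw' : ModuleCat.ofHom w ≫ S.g = Abelian.Ext.homEquiv₀ y := by
      ext1
      exact hw
    -- `x` is the product of `y` with the class of the extension, and `S.g` times that class is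
    -- zero.
    rw [← hy, ← Abelian.Ext.mk₀_homEquiv₀_apply y, ← hw', ← Abelian.Ext.mk₀_comp_mk₀,
      Abelian.Ext.comp_assoc_of_second_deg_zero, hS.comp_extClass, Abelian.Ext.comp_zero]
  | succ n ih =>
    let S := ShortComplex.mk (Injective.ι M) (Limits.cokernel.π (Injective.ι M)) (by simp)
    have hS : S.ShortExact := { exact := ShortComplex.exact_cokernel _ }
    obtain ⟨y, hy⟩ := Abelian.Ext.covariant_sequence_exact₁ _ hS x
      (Abelian.Ext.eq_zero_of_injective _) rfl
    rw [← hy, ih S.X₃ ?_ y, Abelian.Ext.zero_comp]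
    let := restrictRight φ M
    let := restrictRight φ S.X₂
    let := restrictRight φ S.X₃
    have : Module.Injective Rᵐᵒᵖ S.X₂ :=
      Module.injective_module_of_injective_object _ _
        (inj := inferInstanceAs (Injective (Injective.under M)))
    exact baer_of_exact hM (hφ.baer_of_injective fun _ _ => rfl)
      { S.f.hom with map_smul' := fun _ _ => S.f.hom.map_smul _ _ }
      { S.g.hom with map_smul' := fun _ _ => S.g.hom.map_smul _ _ }
      ((ModuleCat.mono_iff_injective _).1 hS.mono_f)
      ((ShortComplex.ShortExact.moduleCat_exact_iff_function_exact S).1 hS.exact)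
      ((ModuleCat.epi_iff_surjective _).1 hS.epi_g)

end Ext

/-! ### Flatness of differential operators over functions, and supports on charts -/

/-- The inclusion of the functions into the differential operators. -/
def fnHom (A : Type) [CommRing A] [Algebra ℂ A] : A →+* D A where
  toFun := fn
  map_one' := fn_one
  map_mul' := fn_mul
  map_zero' := fn_zero
  map_add' := fn_add

/-- Finitely many operators have a common order bound, so one dual basis expands them all. The
coefficients inherit the relation, since on `b ⊗ c` it is `b` times the given relation applied to
`c`. -/
theorem equationallyFlat_fnHom (A : Type) [CommRing A] [Algebra ℂ A] [Algebra.Smooth ℂ A] :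
    EquationallyFlat (R := D A) (fnHom A) := by
  intro κ s a d h
  choose o ho using fun k => (d k).2
  obtain ⟨ι, _, z, e, he⟩ := exists_dualBasis (A := A) (s.sup o)
  refine ⟨ι, inferInstance, fun j k => leftExt (d k).1 (z j), e,
    fun k hk => he _ ((ho k).mono (Finset.le_sup hk)), fun j => ?_⟩
  have key : ∀ w : A ⊗[ℂ] A, ∑ k ∈ s, a k * leftExt (d k).1 w = 0 := by
    intro w
    induction w using TensorProduct.induction_on with
    | zero => simp
    | tmul b c =>
      have h1 := LinearMap.congr_fun (congrArg Subtype.val h) c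
      rw [AddSubmonoidClass.coe_finsetSum, LinearMap.sum_apply] at h1
      calc ∑ k ∈ s, a k * leftExt (d k).1 (b ⊗ₜ c) = b * ∑ k ∈ s, a k * (d k).1 c := by
            rw [Finset.mul_sum]
            refine Finset.sum_congr rfl fun k _ => ?_
            rw [leftExt_tmul]; ring
        _ = b * 0 := congrArg (b * ·) h1
        _ = 0 := mul_zero b
    | add u v hu hv => simp only [map_add, mul_add, Finset.sum_add_distrib, hu, hv, add_zero]
  exact key (z j)

/-- A point of the support of a `D`-module in a chart is the image of a point of `X`. -/
theorem DModule.exists_point_of_mem_supp {X : Scheme.{0}} {f : X ⟶ Spec (CommRingCat.of ℂ)}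
    (M : DModule f) (c : Chart f) {p : PrimeSpectrum c.A} (hp : p ∈ supp c.A (M.obj c)) :
    ∃ (x : X) (hx : x ∈ c.U), p = c.point x hx := by
  have hle : RingHom.ker c.π ≤ p.asIdeal := M.supp_subset c hp
  have hmem : p ∈ Set.range (PrimeSpectrum.comap c.π) := by
    rw [_root_.range_comap_of_surjective _ _ c.surj]
    exact hle
  obtain ⟨q, rfl⟩ := hmem
  let x : c.U := ⟨c.isAffine.fromSpec q, by
    rw [← SetLike.mem_coe, ← c.isAffine.range_fromSpec]; exact ⟨q, rfl⟩⟩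
  have hq : c.isAffine.primeIdealOf x = q :=
    c.isAffine.fromSpec.isOpenEmbedding.injective (c.isAffine.fromSpec_primeIdealOf x)
  refine ⟨x.1, x.2, ?_⟩
  rw [← hq, c.isAffine.primeIdealOf_eq_map_closedPoint]
  rfl

/-- The vanishing of `Ext` for a right `D`-module supported at no more than one point. -/
theorem subsingleton_ext_of_supp_subsingleton {A : Type} [CommRing A] [Algebra ℂ A]
    [Algebra.Smooth ℂ A] (I : Ideal A) (M : ModuleCat.{0} (D A)ᵐᵒᵖ)
    (hM : (supp A M).Subsingleton) {i : ℕ} (hi : 1 ≤ i) :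
    Subsingleton (Abelian.Ext (canonicalModule I) M i) := by
  obtain ⟨n, rfl⟩ := Nat.exists_eq_add_of_le' hi
  let := restrictRight (R := D A) (fnHom A) M
  exact (equationallyFlat_fnHom A).subsingleton_ext I n M
    (baer_of_supp_subsingleton (fun _ _ => rfl) hM)

end DMod

end

theorem mainTheorem7 :
    (∀ (A : Type) [CommRing A] [Algebra ℂ A] [Algebra.Smooth ℂ A] (I : Ideal A), I.IsRadical →
      ∀ M : ModuleCat.{0} (DMod.D A)ᵐᵒᵖ,
        DMod.supp A M ⊆ PrimeSpectrum.zeroLocus (I : Set A) →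
        (∃ p : PrimeSpectrum A, DMod.supp A M ⊆ {p}) →
        ∀ i : ℕ, 1 ≤ i → Subsingleton (Abelian.Ext (DMod.canonicalModule I) M i)) ∧
    (∀ (X : Scheme.{0}) (f : X ⟶ Spec (CommRingCat.of ℂ)) [IsReduced X] [IsSeparated f]
      [LocallyOfFiniteType f] [QuasiCompact f] (M : DMod.DModule f),
        (∃ x : X, M.support ⊆ {x}) →
        ∀ i : ℕ, 1 ≤ i → ∀ c : DMod.Chart f,
          Subsingleton (Abelian.Ext (DMod.canonicalModule c.ideal) (M.obj c) i)) := by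
  refine ⟨fun A _ _ _ I _ M _ ⟨p, hp⟩ i hi =>
    DMod.subsingleton_ext_of_supp_subsingleton I M (Set.subsingleton_singleton.anti hp) hi, ?_⟩
  intro X f _ _ _ _ M ⟨x, hx⟩ i hi c
  -- Support points of a chart come from points of `X` in `M.support`, so only the image of `x` can
  -- occur and the affine case applies.
  have hpt : ∀ p ∈ DMod.supp c.A (M.obj c), ∃ hxU : x ∈ c.U, p = c.point x hxU := by
    intro p hp
    obtain ⟨y, hyU, rfl⟩ := M.exists_point_of_mem_supp c hp
    obtain rfl : y = x := hx ⟨c, hyU, hp⟩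
    exact ⟨hyU, rfl⟩
  refine DMod.subsingleton_ext_of_supp_subsingleton c.ideal (M.obj c) (fun p hp q hq => ?_) hi
  obtain ⟨_, rfl⟩ := hpt p hp
  obtain ⟨_, rfl⟩ := hpt q hq
  rfl
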